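/- Let $n\ge 1$ be an integer and let $p,q\in[1,\infty]$ be conjugate exponents, $1/p+1/q=1$ with $1/\infty=0$. Let $\mathcal P_n$ be the set of monic real polynomials of degree $n$. For $a<b$ let $\|\cdot\|_p$ denote the norm of $L^p([a,b])$, and let $W_{a,b}$ be the set of functions $f:[a,b]\to\mathbb R$ such that $f^{(n-1)}$ exists and is absolutely continuous on $[a,b]$ and $f^{(n)}\in L^p([a,b])$. For $\phi\in\mathcal P_n$ and $f\in W_{a,b}$ put $$E_n(f)=E_n^{\phi}(f)=\frac{(-1)^n}{n!}\int_a^b f^{(n)}(x)\,\phi(x)\,dx .$$ (1) For all $a<b$, $f\in W_{a,b}$ and $\phi\in\mathcal P_n$ the integrals exist, $$\int_a^b f(x)\,dx=\frac{(-1)^n}{n!}\sum_{k=0}^{n-1}(-1)^{n-k-1}\left[\phi^{(n-k-1)}(a)f^{(k)}(a)-\phi^{(n-k-1)}(b)f^{(k)}(b)\right]+E_n(f),$$ and $|E_n(f)|\le \|f^{(n)}\|_p\|\phi\|_q/n!$. (2) For $a<b$, each $\phi\in\mathcal P_n$ can be written as $\phi=\psi_{a,b}$ for exactly one $\psi\in\mathcal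 P_n$, where $$\psi_{a,b}(x)=\left(\frac{b-a}{2}\right)^{n}\psi\!\left(\frac{2x-a-b}{b-a}\right),$$ and conversely $\psi_{a,b}\in\mathcal P_n$ for every $\psi\in\mathcal P_n$. For each $\psi\in\mathcal P_n$ there is a least constant $K_{n,p}=K_{n,p}(\psi)$, depending only on $n$, $p$ and $\psi$, such that for all $a<b$ and all $f\in W_{a,b}$, with $\phi=\psi_{a,b}$, $$\frac{\|f^{(n)}\|_p\|\phi\|_q}{n!}\le K_{n,p}(\psi)\,\|f^{(n)}\|_p\,(b-a)^{n+1/q}.$$ (3) There is a unique $\tilde\phi_n\in\mathcal P_n$ that minimizes $K_{n,p}(\psi)$ over $\psi\in\mathcal P_n$. The minimum is $$\tilde K_{n,p}=K_{n,p}(\tilde\phi_n)=\frac{2^{-n-1/q}\,\|\tilde\phi_n\|_q}{n!},$$ with the norm of $\tilde\phi_n$ taken over $[-1,1]$. (4) The resulting estimate is sharp: for all $a<b$, with $\phi=(\tilde\phi_n)_{a,b}$, the number $\tilde K_{n,p}(b-a)^{n+1/q}$ is the least real $c$ such that $|E_n(f)|\le c\,\|f^{(n)}\|_p$ for all $f\in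 W_{a,b}$. -/

import Mathlib

open MeasureTheory Polynomial
open scoped ENNReal

noncomputable section

namespace CorrectedTrapezoid

/-- The `L^p` norm of `g` over `[a, b]` with respect to Lebesgue measure. -/
def normOn (g : ℝ → ℝ) (p : ℝ≥0∞) (a b : ℝ) : ℝ :=
  lpNorm g p (volume.restrict (Set.Icc a b))

/-- The `k`-th derivative of `f` as a function on `[a, b]` (one-sided at the endpoints). -/
def derivOn (k : ℕ) (f : ℝ → ℝ) (a b : ℝ) : ℝ → ℝ :=
  iteratedDerivWithin k f (Set.Icc a b)

/-- The functions `f` on `[a, b]` whose derivative of order `n - 1` exists and is absolutely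
continuous, and whose derivative of order `n` is in `L^p([a, b])`. It is used for `1 ≤ n`. -/
structure IsRegular (n : ℕ) (p : ℝ≥0∞) (a b : ℝ) (f : ℝ → ℝ) : Prop where
  contDiffOn : ContDiffOn ℝ ((n - 1 : ℕ) : WithTop ℕ∞) f (Set.Icc a b)
  absolutelyContinuous : AbsolutelyContinuousOnInterval (derivOn (n - 1) f a b) a b
  memLp : MemLp (derivOn n f a b) p (volume.restrict (Set.Icc a b))

/-- The monic real polynomials of degree `n`. -/
def monicPolys (n : ℕ) : Set ℝ[X] := {φ | φ.Monic ∧ φ.natDegree = n}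

/-- The boundary terms of the corrected trapezoidal rule built on `φ`. -/
def quadrature (n : ℕ) (φ : ℝ[X]) (f : ℝ → ℝ) (a b : ℝ) : ℝ :=
  (-1) ^ n / (n.factorial : ℝ) * ∑ k ∈ Finset.range n, (-1) ^ (n - k - 1) *
    ((derivative^[n - k - 1] φ).eval a * derivOn k f a b a -
      (derivative^[n - k - 1] φ).eval b * derivOn k f a b b)

/-- The error term `E_n(f)`. -/
def errorTerm (n : ℕ) (φ : ℝ[X]) (f : ℝ → ℝ) (a b : ℝ) : ℝ :=
  (-1) ^ n / (n.factorial : ℝ) * ∫ x in a..b, derivOn n f a b x * φ.eval x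

/-- The polynomial `x ↦ ((b - a) / 2) ^ n * ψ ((2 x - a - b) / (b - a))`, that is, `ψ` carried
from `[-1, 1]` to `[a, b]` with its leading coefficient kept. -/
def transplant (n : ℕ) (a b : ℝ) (ψ : ℝ[X]) : ℝ[X] :=
  C (((b - a) / 2) ^ n) * ψ.comp (C (2 / (b - a)) * X - C ((a + b) / (b - a)))

/-- The constants `K` that, for the polynomials coming from `ψ`, serve in the estimate
`‖f^(n)‖_p ‖φ‖_q / n! ≤ K ‖f^(n)‖_p (b - a) ^ (n + 1/q)` for all intervals and all `f`. -/
def admissibleConstants (n : ℕ) (p q : ℝ≥0∞) (ψ : ℝ[X]) : Set ℝ :=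
  {K | ∀ a b : ℝ, a < b → ∀ f : ℝ → ℝ, IsRegular n p a b f →
    normOn (derivOn n f a b) p a b * normOn (fun x => (transplant n a b ψ).eval x) q a b /
        (n.factorial : ℝ) ≤
      K * normOn (derivOn n f a b) p a b * (b - a) ^ ((n : ℝ) + (q⁻¹).toReal)}

/-- The constant `K_{n,p}` that belongs to `ψ`: the best admissible one. -/
def errorConst (n : ℕ) (p q : ℝ≥0∞) (ψ : ℝ[X]) : ℝ :=
  sInf (admissibleConstants n p q ψ)

/-- `ψ` minimizes `K_{n,p}` over the monic polynomials of degree `n`. -/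
def IsMinimizer (n : ℕ) (p q : ℝ≥0∞) (ψ : ℝ[X]) : Prop :=
  ψ ∈ monicPolys n ∧ ∀ χ ∈ monicPolys n, errorConst n p q ψ ≤ errorConst n p q χ

end CorrectedTrapezoid

end

/-!
Integrating `∫ φ⁽ⁿ⁾ f = n! ∫ f` by parts `n` times gives the quadrature formula, and Hölder's
inequality gives the bound for its error term. Every `g ∈ L^p` is the `n`-th derivative of an
admissible `f` (integrate `n` times), so the converse of Hölder's inequality makes the bound
sharp. An affine change of variable shows that the constant belonging to `ψ` is
`2 ^ (-n - 1/q) ‖ψ‖_q / n!` with the norm taken over `[-1, 1]`, so that minimizing it amounts to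
finding the monic polynomial of least `L^q` norm on `[-1, 1]`.

A minimizer exists because the distance to a finite-dimensional subspace is attained. It is unique
by strict convexity when `1 < q < ∞`, and it is the normalized Chebyshev polynomial when `q = ∞`.
For `q = 1`, the first variation shows that the sign of a minimizer is orthogonal to all
polynomials of degree less than `n`, so a minimizer has `n` distinct roots in the interval.
The midpoint of two minimizers is again a minimizer, and equality in the triangle inequality
makes each of its roots a common root of both. They therefore agree at `n` points, and their
difference has degree less than `n`.
-/

noncomputable section

namespace CorrectedTrapezoid

section LpSpaces

variable {α : Type*} {m : MeasurableSpace α} {μ : Measure α} {p q : ℝ≥0∞}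

lemma lpNorm_congr_ae {E : Type*} [NormedAddCommGroup E] {f g : α → E} (h : f =ᵐ[μ] g) :
    lpNorm f p μ = lpNorm g p μ := by
  by_cases hf : AEStronglyMeasurable f μ
  · rw [← toReal_eLpNorm hf, ← toReal_eLpNorm (hf.congr h), eLpNorm_congr_ae h]
  · rw [lpNorm_of_not_aestronglyMeasurable hf,
      lpNorm_of_not_aestronglyMeasurable (mt (aestronglyMeasurable_congr h).2 hf)]

lemma lpNorm_top_le_of_ae_le {E : Type*} [NormedAddCommGroup E] {f : α → E} {c : ℝ} (hc : 0 ≤ c)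
    (h : ∀ᵐ x ∂μ, ‖f x‖ ≤ c) : lpNorm f ∞ μ ≤ c := by
  by_cases hf : AEStronglyMeasurable f μ
  · rw [← toReal_eLpNorm hf]
    exact ENNReal.toReal_le_of_le_ofReal hc (eLpNormEssSup_le_of_ae_bound h)
  · rwa [lpNorm_of_not_aestronglyMeasurable hf]

lemma integral_norm_rpow_eq_lpNorm_rpow {E : Type*} [NormedAddCommGroup E] {f : α → E}
    (hf : AEStronglyMeasurable f μ) (hp : p ≠ 0) (hp' : p ≠ ∞) :
    ∫ x, ‖f x‖ ^ p.toReal ∂μ = lpNorm f p μ ^ p.toReal := by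
  rw [lpNorm_eq_integral_norm_rpow_toReal hp hp' hf,
    Real.rpow_inv_rpow (by positivity) (ENNReal.toReal_pos hp hp').ne']

section Duality

variable [p.HolderConjugate q] {f g φ : α → ℝ}

lemma abs_integral_mul_le_lpNorm_mul_lpNorm (hf : MemLp f p μ) (hg : MemLp g q μ) :
    |∫ x, f x * g x ∂μ| ≤ lpNorm f p μ * lpNorm g q μ := by
  have hölder : eLpNorm (f • g) 1 μ ≤ eLpNorm f p μ * eLpNorm g q μ :=
    eLpNorm_smul_le_mul_eLpNorm hg.1 hf.1
  calc |∫ x, f x * g x ∂μ| ≤ ∫ x, ‖(f • g) x‖ ∂μ := norm_integral_le_integral_norm (f • g)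
    _ = lpNorm (f • g) 1 μ := (lpNorm_one_eq_integral_norm (hf.1.smul hg.1)).symm
    _ ≤ lpNorm f p μ * lpNorm g q μ := by
      rw [← toReal_eLpNorm (hf.1.smul hg.1), ← toReal_eLpNorm hf.1, ← toReal_eLpNorm hg.1,
        ← ENNReal.toReal_mul]
      exact ENNReal.toReal_mono (ENNReal.mul_ne_top hf.2.ne hg.2.ne) hölder

lemma measurable_coe_sign : Measurable fun x : ℝ => (SignType.sign x : ℝ) := by
  have h := measurable_deriv fun x : ℝ => |x|
  rwa [funext deriv_abs] at h

lemma abs_coe_sign_le_one (x : ℝ) : |(SignType.sign x : ℝ)| ≤ 1 := by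
  rcases lt_trichotomy x 0 with h | rfl | h <;> simp [*]

lemma aestronglyMeasurable_coe_sign (hf : AEStronglyMeasurable f μ) :
    AEStronglyMeasurable (fun x => (SignType.sign (f x) : ℝ)) μ :=
  (measurable_coe_sign.comp_aemeasurable hf.aemeasurable).aestronglyMeasurable

lemma aestronglyMeasurable_sign_mul_abs_rpow (hφ : AEStronglyMeasurable φ μ) (r : ℝ) :
    AEStronglyMeasurable (fun x => SignType.sign (φ x) * |φ x| ^ r) μ :=
  (aestronglyMeasurable_coe_sign hφ).mul (hφ.norm.aemeasurable.pow_const r).aestronglyMeasurable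

lemma sign_mul_abs_rpow_sub_one_mul_self {r : ℝ} (hr : 0 < r) (x : ℝ) :
    SignType.sign x * |x| ^ (r - 1) * x = |x| ^ r := by
  rcases eq_or_ne x 0 with rfl | hx
  · simp [Real.zero_rpow hr.ne']
  · rw [mul_right_comm, sign_mul_self, mul_comm, ← Real.rpow_add_one (abs_ne_zero.2 hx),
      sub_add_cancel]

lemma eLpNorm_sign_mul_abs_rpow_le (hq : q ≠ ∞) (φ : α → ℝ) :
    eLpNorm (fun x => SignType.sign (φ x) * |φ x| ^ (q.toReal - 1)) p μ ≤
      eLpNorm φ q μ ^ (q.toReal - 1) := by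
  have hbound (x : α) : ‖SignType.sign (φ x) * |φ x| ^ (q.toReal - 1)‖ ≤
      ‖φ x‖ ^ (q.toReal - 1) := by
    rw [norm_mul, Real.norm_of_nonneg (by positivity : 0 ≤ |φ x| ^ (q.toReal - 1))]
    exact mul_le_of_le_one_left (by positivity) (abs_coe_sign_le_one _)
  rcases eq_or_ne p ∞ with rfl | hp
  · obtain rfl : q = 1 := (ENNReal.HolderConjugate.eq_top_iff_eq_one ∞ q).1 rfl
    simp only [ENNReal.toReal_one, sub_self, Real.rpow_zero, ENNReal.rpow_zero] at hbound ⊢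
    simpa using eLpNormEssSup_le_of_ae_bound (.of_forall hbound)
  · have hconj := ENNReal.HolderConjugate.toReal_of_ne_top hp hq
    have hexp : p * ENNReal.ofReal (q.toReal - 1) = q := by
      rw [← ENNReal.toReal_eq_toReal_iff' (by finiteness) hq, ENNReal.toReal_mul,
        ENNReal.toReal_ofReal hconj.symm.sub_one_pos.le, mul_comm]
      exact hconj.symm.sub_one_mul_conj
    calc _ ≤ eLpNorm (fun x => ‖φ x‖ ^ (q.toReal - 1)) p μ := eLpNorm_mono_real hbound
      _ = eLpNorm φ q μ ^ (q.toReal - 1) := by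
        rw [eLpNorm_norm_rpow φ hconj.symm.sub_one_pos, hexp]

lemma lpNorm_le_of_forall_abs_integral_mul_le_of_ne_top (hq : q ≠ ∞) (hφ : MemLp φ q μ) {c : ℝ}
    (hc : 0 ≤ c) (H : ∀ g, MemLp g p μ → |∫ x, g x * φ x ∂μ| ≤ c * lpNorm g p μ) :
    lpNorm φ q μ ≤ c := by
  have hQ : 1 ≤ q.toReal := by
    simpa using ENNReal.toReal_mono hq (ENNReal.HolderConjugate.one_le q p)
  set g : α → ℝ := fun x => SignType.sign (φ x) * |φ x| ^ (q.toReal - 1)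
  have hg_meas : AEStronglyMeasurable g μ := aestronglyMeasurable_sign_mul_abs_rpow hφ.1 _
  have hg_le : eLpNorm g p μ ≤ eLpNorm φ q μ ^ (q.toReal - 1) := eLpNorm_sign_mul_abs_rpow_le hq φ
  have hfin : eLpNorm φ q μ ^ (q.toReal - 1) ≠ ∞ :=
    ENNReal.rpow_ne_top_of_nonneg (by linarith) hφ.2.ne
  have hg_norm : lpNorm g p μ ≤ lpNorm φ q μ ^ (q.toReal - 1) := by
    rw [← toReal_eLpNorm hg_meas, ← toReal_eLpNorm hφ.1, ENNReal.toReal_rpow]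
    exact ENNReal.toReal_mono hfin hg_le
  have hpair : ∫ x, g x * φ x ∂μ = lpNorm φ q μ ^ q.toReal := by
    rw [← integral_norm_rpow_eq_lpNorm_rpow hφ.1 (ENNReal.HolderConjugate.ne_zero q p) hq]
    exact integral_congr_ae (.of_forall fun x =>
      sign_mul_abs_rpow_sub_one_mul_self (by linarith) (φ x))
  rcases (lpNorm_nonneg (f := φ) (p := q) (μ := μ)).eq_or_lt with h0 | hpos
  · rwa [← h0]
  refine le_of_mul_le_mul_right ?_ (Real.rpow_pos_of_pos hpos (q.toReal - 1))
  calc lpNorm φ q μ * lpNorm φ q μ ^ (q.toReal - 1) = lpNorm φ q μ ^ q.toReal := by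
        rw [mul_comm, ← Real.rpow_add_one hpos.ne', sub_add_cancel]
    _ ≤ c * lpNorm g p μ :=
      hpair ▸ (le_abs_self _).trans (H g ⟨hg_meas, hg_le.trans_lt hfin.lt_top⟩)
    _ ≤ c * lpNorm φ q μ ^ (q.toReal - 1) := by gcongr

lemma setIntegral_abs_le_of_forall_abs_integral_mul_le (hφ : AEStronglyMeasurable φ μ) {c : ℝ}
    (hc : 0 ≤ c) (H : ∀ g, MemLp g 1 μ → |∫ x, g x * φ x ∂μ| ≤ c * lpNorm g 1 μ) {s : Set α}
    (hs : MeasurableSet s) (hμs : μ s < ∞) : ∫ x in s, |φ x| ∂μ ≤ c * μ.real s := by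
  set g : α → ℝ := s.indicator fun x => (SignType.sign (φ x) : ℝ)
  have hg_int : Integrable g μ := (integrable_indicator_iff hs).2 (.of_bound hμs
    (aestronglyMeasurable_coe_sign hφ).restrict 1 (.of_forall fun x => abs_coe_sign_le_one _))
  have hg_norm : lpNorm g 1 μ ≤ μ.real s := by
    rw [lpNorm_one_eq_integral_norm hg_int.1, ← integral_indicator_one hs]
    refine integral_mono hg_int.norm
      ((integrable_indicator_iff hs).2 (integrableOn_const hμs.ne)) fun x => ?_
    by_cases hx : x ∈ s <;> simp [g, hx, abs_coe_sign_le_one]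
  have hpair : ∫ x in s, |φ x| ∂μ = ∫ x, g x * φ x ∂μ := by
    rw [← integral_indicator hs]
    congr with x
    by_cases hx : x ∈ s <;> simp [g, hx, sign_mul_self]
  calc ∫ x in s, |φ x| ∂μ ≤ c * lpNorm g 1 μ :=
        hpair ▸ (le_abs_self _).trans (H g (memLp_one_iff_integrable.2 hg_int))
    _ ≤ c * μ.real s := by gcongr

lemma lpNorm_top_le_of_forall_abs_integral_mul_le [SigmaFinite μ] (hφ : MemLp φ ∞ μ) {c : ℝ}
    (hc : 0 ≤ c) (H : ∀ g, MemLp g 1 μ → |∫ x, g x * φ x ∂μ| ≤ c * lpNorm g 1 μ) :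
    lpNorm φ ∞ μ ≤ c := by
  have hint (s : Set α) (hs : μ s < ∞) : IntegrableOn (fun x => |φ x|) s μ := by
    have : IsFiniteMeasure (μ.restrict s) := isFiniteMeasure_restrict.2 hs.ne
    exact ((hφ.restrict s).integrable le_top).abs
  have hconst (s : Set α) (hμs : μ s < ∞) : IntegrableOn (fun _ => c) s μ :=
    integrableOn_const hμs.ne
  have hnonneg : 0 ≤ᵐ[μ] fun x => c - |φ x| :=
    ae_nonneg_of_forall_setIntegral_nonneg_of_sigmaFinite
      (fun s _ hμs => (hconst s hμs).sub (hint s hμs)) fun s hs hμs => by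
        rw [integral_sub (hconst s hμs) (hint s hμs), setIntegral_const, smul_eq_mul, mul_comm]
        exact sub_nonneg.2 (setIntegral_abs_le_of_forall_abs_integral_mul_le hφ.1 hc H hs hμs)
  refine lpNorm_top_le_of_ae_le hc ?_
  filter_upwards [hnonneg] with x hx using sub_nonneg.1 hx

lemma lpNorm_le_of_forall_abs_integral_mul_le [SigmaFinite μ] (hφ : MemLp φ q μ) {c : ℝ}
    (hc : 0 ≤ c) (H : ∀ g, MemLp g p μ → |∫ x, g x * φ x ∂μ| ≤ c * lpNorm g p μ) :
    lpNorm φ q μ ≤ c := by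
  rcases eq_or_ne q ∞ with rfl | hq
  · obtain rfl : p = 1 := (ENNReal.HolderConjugate.eq_top_iff_eq_one ∞ p).1 rfl
    exact lpNorm_top_le_of_forall_abs_integral_mul_le hφ hc H
  · exact lpNorm_le_of_forall_abs_integral_mul_le_of_ne_top hq hφ hc H

end Duality

section StrictConvexity

variable {E : Type*} [NormedAddCommGroup E] [NormedSpace ℝ E]

lemma norm_midpoint_le (x y : E) : ‖midpoint ℝ x y‖ ≤ (‖x‖ + ‖y‖) / 2 := by
  rw [midpoint_eq_smul_add, norm_smul, invOf_eq_inv, norm_inv, Real.norm_two, div_eq_inv_mul]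
  gcongr
  exact norm_add_le x y

lemma norm_midpoint_rpow_le {r : ℝ} (hr : 1 ≤ r) (x y : E) :
    ‖midpoint ℝ x y‖ ^ r ≤ (‖x‖ ^ r + ‖y‖ ^ r) / 2 := by
  have hconv := (convexOn_rpow hr).2 (norm_nonneg x) (norm_nonneg y)
    one_half_pos.le one_half_pos.le (add_halves 1)
  calc ‖midpoint ℝ x y‖ ^ r ≤ ((‖x‖ + ‖y‖) / 2) ^ r := by
        gcongr
        exact norm_midpoint_le x y
    _ = ((1 / 2 : ℝ) • ‖x‖ + (1 / 2 : ℝ) • ‖y‖) ^ r := by simp only [smul_eq_mul]; ring_nf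
    _ ≤ (‖x‖ ^ r + ‖y‖ ^ r) / 2 := hconv.trans_eq (by simp only [smul_eq_mul]; ring)

lemma eq_of_norm_midpoint_rpow_eq [StrictConvexSpace ℝ E] {r : ℝ} (hr : 1 < r) {x y : E}
    (h : ‖midpoint ℝ x y‖ ^ r = (‖x‖ ^ r + ‖y‖ ^ r) / 2) : x = y := by
  have hnorm : ‖x‖ = ‖y‖ := by
    by_contra hne
    have hlt := (strictConvexOn_rpow hr).2 (norm_nonneg x) (norm_nonneg y) hne
      one_half_pos one_half_pos (add_halves 1)
    have hle : ‖midpoint ℝ x y‖ ^ r ≤ ((1 / 2 : ℝ) • ‖x‖ + (1 / 2 : ℝ) • ‖y‖) ^ r := by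
      gcongr
      exact (norm_midpoint_le x y).trans_eq (by simp only [smul_eq_mul]; ring)
    simp only [smul_eq_mul] at hlt hle
    linarith
  by_contra hne
  have hlt : ‖midpoint ℝ x y‖ < ‖x‖ := by
    rw [midpoint_eq_smul_add, invOf_eq_inv, ← one_div]
    exact (norm_midpoint_lt_iff hnorm).2 hne
  rw [← hnorm, add_self_div_two] at h
  exact (Real.rpow_lt_rpow (norm_nonneg _) hlt (by linarith)).ne h

variable {f g : α → E}

lemma memLp_midpoint (hf : MemLp f p μ) (hg : MemLp g p μ) :
    MemLp (fun x => midpoint ℝ (f x) (g x)) p μ := by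
  simp only [midpoint_eq_smul_add]
  exact (hf.add hg).const_smul _

lemma ae_norm_midpoint_rpow_eq_of_lpNorm_le (hq : 1 ≤ q) (hq' : q ≠ ∞) (hf : MemLp f q μ)
    (hg : MemLp g q μ) (hfm : lpNorm f q μ ≤ lpNorm (fun x => midpoint ℝ (f x) (g x)) q μ)
    (hgm : lpNorm g q μ ≤ lpNorm (fun x => midpoint ℝ (f x) (g x)) q μ) :
    ∀ᵐ x ∂μ, ‖midpoint ℝ (f x) (g x)‖ ^ q.toReal =
      (‖f x‖ ^ q.toReal + ‖g x‖ ^ q.toReal) / 2 := by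
  have hq0 : q ≠ 0 := (one_pos.trans_le hq).ne'
  have hQ : 1 ≤ q.toReal := by simpa using ENNReal.toReal_mono hq' hq
  have hm : MemLp (fun x => midpoint ℝ (f x) (g x)) q μ := memLp_midpoint hf hg
  have hfi := hf.integrable_norm_rpow hq0 hq'
  have hgi := hg.integrable_norm_rpow hq0 hq'
  have hmi := hm.integrable_norm_rpow hq0 hq'
  have hfgi : Integrable (fun x => (‖f x‖ ^ q.toReal + ‖g x‖ ^ q.toReal) / 2) μ :=
    (hfi.add hgi).div_const 2
  have hpos (x : α) : 0 ≤ (‖f x‖ ^ q.toReal + ‖g x‖ ^ q.toReal) / 2 -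
      ‖midpoint ℝ (f x) (g x)‖ ^ q.toReal := sub_nonneg.2 (norm_midpoint_rpow_le hQ _ _)
  have hint : ∫ x, ((‖f x‖ ^ q.toReal + ‖g x‖ ^ q.toReal) / 2 -
      ‖midpoint ℝ (f x) (g x)‖ ^ q.toReal) ∂μ = 0 := by
    refine le_antisymm ?_ (integral_nonneg hpos)
    rw [integral_sub hfgi hmi, integral_div, integral_add hfi hgi,
      integral_norm_rpow_eq_lpNorm_rpow hf.1 hq0 hq',
      integral_norm_rpow_eq_lpNorm_rpow hg.1 hq0 hq',
      integral_norm_rpow_eq_lpNorm_rpow hm.1 hq0 hq']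
    have hfr := Real.rpow_le_rpow lpNorm_nonneg hfm (zero_le_one.trans hQ)
    have hgr := Real.rpow_le_rpow lpNorm_nonneg hgm (zero_le_one.trans hQ)
    linarith
  filter_upwards [(integral_eq_zero_iff_of_nonneg hpos (hfgi.sub hmi)).1 hint] with x hx
  exact (sub_eq_zero.1 hx).symm

lemma ae_eq_of_lpNorm_le_lpNorm_midpoint [StrictConvexSpace ℝ E] (hq : 1 < q) (hq' : q ≠ ∞)
    (hf : MemLp f q μ) (hg : MemLp g q μ)
    (hfm : lpNorm f q μ ≤ lpNorm (fun x => midpoint ℝ (f x) (g x)) q μ)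
    (hgm : lpNorm g q μ ≤ lpNorm (fun x => midpoint ℝ (f x) (g x)) q μ) : f =ᵐ[μ] g := by
  have hQ : 1 < q.toReal := by simpa using (ENNReal.toReal_lt_toReal (by simp) hq').2 hq
  filter_upwards [ae_norm_midpoint_rpow_eq_of_lpNorm_le hq.le hq' hf hg hfm hgm] with x hx
  exact eq_of_norm_midpoint_rpow_eq hQ hx

end StrictConvexity

section FirstVariation

variable {f g : α → ℝ}

lemma hasDerivAt_integral_abs_add_mul (hf : Integrable f μ) (hg : Integrable g μ)
    (hf0 : ∀ᵐ x ∂μ, f x ≠ 0) :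
    HasDerivAt (fun t : ℝ => ∫ x, |f x + t * g x| ∂μ) (∫ x, SignType.sign (f x) * g x ∂μ) 0 := by
  refine (hasDerivAt_integral_of_dominated_loc_of_lip (bound := fun x => |g x|) Filter.univ_mem
    (.of_forall fun t => (hf.1.add (hg.1.const_mul t)).norm) (by simpa using hf.abs)
    ((aestronglyMeasurable_coe_sign hf.1).mul hg.1) (.of_forall fun x => ?_) hg.abs ?_).2
  · refine LipschitzOnWith.of_dist_le_mul fun s _ t _ => ?_
    rw [Real.coe_nnabs, abs_abs, Real.dist_eq, Real.dist_eq]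
    calc |(|f x + s * g x| - |f x + t * g x|)| ≤ |f x + s * g x - (f x + t * g x)| :=
          abs_abs_sub_abs_le_abs_sub _ _
      _ = |g x| * |s - t| := by rw [← abs_mul]; ring_nf
  · filter_upwards [hf0] with x hx
    have hline : HasDerivAt (fun t => f x + t * g x) (g x) 0 := by
      simpa using ((hasDerivAt_id (0 : ℝ)).mul_const (g x)).const_add (f x)
    have habs : HasDerivAt (fun y : ℝ => |y|) (SignType.sign (f x)) (f x + 0 * g x) := by
      simpa using hasDerivAt_abs hx
    exact habs.comp 0 hline

lemma integral_sign_mul_eq_zero_of_forall_integral_abs_le (hf : Integrable f μ)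
    (hg : Integrable g μ) (hf0 : ∀ᵐ x ∂μ, f x ≠ 0)
    (hmin : ∀ t : ℝ, ∫ x, |f x| ∂μ ≤ ∫ x, |f x + t * g x| ∂μ) :
    ∫ x, SignType.sign (f x) * g x ∂μ = 0 :=
  IsLocalMin.hasDerivAt_eq_zero (.of_forall fun t => by simpa using hmin t)
    (hasDerivAt_integral_abs_add_mul hf hg hf0)

end FirstVariation

end LpSpaces

section NormOn

variable {a b : ℝ}

lemma memLp_restrict_Icc {g : ℝ → ℝ} (hg : Continuous g) (q : ℝ≥0∞) (a b : ℝ) :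
    MemLp g q (volume.restrict (Set.Icc a b)) := by
  obtain ⟨M, hM⟩ := isCompact_Icc.exists_bound_of_continuousOn (hg.continuousOn (s := Set.Icc a b))
  exact .of_bound hg.aestronglyMeasurable M (ae_restrict_of_forall_mem measurableSet_Icc hM)

lemma neZero_restrict_Icc (hab : a < b) : NeZero (volume.restrict (Set.Icc a b)) :=
  ⟨by simpa [Measure.restrict_eq_zero] using hab⟩

lemma normOn_comp_mul_add (g : ℝ → ℝ) (q : ℝ≥0∞) {c : ℝ} (hc : 0 < c) (d a b : ℝ) :
    normOn (fun x => g (c * x + d)) q a b =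
      c ^ (-(q⁻¹).toReal) * normOn g q (c * a + d) (c * b + d) := by
  have hT : MeasurableEmbedding fun x => c * x + d :=
    (affineHomeomorph c d hc.ne').measurableEmbedding
  have hmap : Measure.map (fun x => c * x + d) volume = ENNReal.ofReal c⁻¹ • volume := by
    have hcomp : (fun x => c * x + d) = (fun x => x + d) ∘ fun x => c * x := rfl
    rw [hcomp, ← Measure.map_map (measurable_add_const d) (measurable_const_mul c),
      Real.map_volume_mul_left hc.ne', Measure.map_smul, map_add_right_eq_self,
      abs_of_pos (inv_pos.2 hc)]
  have hpre : (fun x => c * x + d) ⁻¹' Set.Icc (c * a + d) (c * b + d) = Set.Icc a b := by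
    ext x
    simp [hc]
  have hrestrict : Measure.map (fun x => c * x + d) (volume.restrict (Set.Icc a b)) =
      c⁻¹.toNNReal • volume.restrict (Set.Icc (c * a + d) (c * b + d)) := by
    rw [← hpre, ← hT.restrict_map, hmap, Measure.restrict_smul]
    rfl
  have hcomp : normOn (fun x => g (c * x + d)) q a b =
      lpNorm g q (Measure.map (fun x => c * x + d) (volume.restrict (Set.Icc a b))) := by
    rw [normOn, lpNorm, lpNorm, hT.eLpNorm_map_measure, hT.aestronglyMeasurable_map_iff]
    rfl
  rw [hcomp, hrestrict, lpNorm_smul_measure_of_ne_zero (by simpa using hc), NNReal.smul_def,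
    NNReal.coe_rpow, Real.coe_toNNReal _ (inv_nonneg.2 hc.le), Real.inv_rpow hc.le,
    ← Real.rpow_neg hc.le, ENNReal.toReal_inv]
  rfl

end NormOn

lemma exists_forall_norm_add_le {𝕜 E : Type*} [NontriviallyNormedField 𝕜] [LocallyCompactSpace 𝕜]
    [NormedAddCommGroup E] [NormedSpace 𝕜 E] (V : Submodule 𝕜 E) [FiniteDimensional 𝕜 V] (x : E) :
    ∃ v ∈ V, ∀ w ∈ V, ‖x + v‖ ≤ ‖x + w‖ := by
  have : ProperSpace V := FiniteDimensional.proper 𝕜 V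
  have hcont : Continuous fun v : V => ‖x + v‖ := by fun_prop
  have hlim : Filter.Tendsto (fun v : V => ‖x + v‖) (Filter.cocompact V) Filter.atTop := by
    refine Filter.tendsto_atTop_mono (f := fun v : V => ‖v‖ - ‖x‖) (fun v => ?_)
      (Filter.tendsto_atTop_add_const_right _ _ tendsto_norm_cocompact_atTop)
    simpa using norm_sub_le (x + v) x
  obtain ⟨v, hv⟩ := hcont.exists_forall_le hlim
  exact ⟨v, v.2, fun w hw => hv ⟨w, hw⟩⟩

section Polynomials

variable {n : ℕ} {ψ χ : ℝ[X]} {a b : ℝ}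

lemma degree_eq_of_mem_monicPolys (hψ : ψ ∈ monicPolys n) : ψ.degree = n := by
  rw [degree_eq_natDegree hψ.1.ne_zero, hψ.2]

lemma X_pow_mem_monicPolys (n : ℕ) : (X ^ n : ℝ[X]) ∈ monicPolys n :=
  ⟨monic_X_pow n, natDegree_X_pow n⟩

lemma mem_monicPolys_iff_sub_mem_degreeLT (hψ : ψ ∈ monicPolys n) :
    χ ∈ monicPolys n ↔ χ - ψ ∈ degreeLT ℝ n := by
  have hψ_deg := degree_eq_of_mem_monicPolys hψ
  rw [mem_degreeLT]
  constructor
  · intro hχ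
    have hχ_deg := degree_eq_of_mem_monicPolys hχ
    exact hχ_deg ▸ degree_sub_lt_left (hχ_deg.trans hψ_deg.symm) hχ.1.ne_zero
      (hχ.1.leadingCoeff.trans hψ.1.leadingCoeff.symm)
  · intro hlt
    rw [← hψ_deg] at hlt
    rw [← add_sub_cancel ψ χ]
    exact ⟨hψ.1.add_of_left hlt, (natDegree_add_eq_left_of_degree_lt hlt).trans hψ.2⟩

lemma add_mem_monicPolys (hψ : ψ ∈ monicPolys n) {r : ℝ[X]} (hr : r ∈ degreeLT ℝ n) :
    ψ + r ∈ monicPolys n := by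
  rwa [mem_monicPolys_iff_sub_mem_degreeLT hψ, add_sub_cancel_left]

lemma convex_monicPolys (n : ℕ) : Convex ℝ (monicPolys n) := by
  intro ψ hψ χ hχ s t _ _ hst
  have hdiff : s • ψ + t • χ = ψ + t • (χ - ψ) := by
    rw [eq_sub_of_add_eq hst]
    module
  rw [hdiff]
  exact add_mem_monicPolys hψ
    (Submodule.smul_mem _ _ ((mem_monicPolys_iff_sub_mem_degreeLT hψ).1 hχ))

lemma eval_midpoint (ψ χ : ℝ[X]) (x : ℝ) :
    (midpoint ℝ ψ χ).eval x = midpoint ℝ (ψ.eval x) (χ.eval x) := by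
  simp [midpoint_eq_smul_add, mul_add]

lemma C_pow_mul_comp_mem_monicPolys (hψ : ψ ∈ monicPolys n) {c : ℝ} (hc : c ≠ 0) (d : ℝ) :
    C (c ^ n) * ψ.comp (C c⁻¹ * X + C d) ∈ monicPolys n := by
  have hdeg : (C c⁻¹ * X + C d : ℝ[X]).natDegree = 1 := natDegree_linear (inv_ne_zero hc)
  constructor
  · rw [Monic, leadingCoeff_mul, leadingCoeff_C, leadingCoeff_comp (by simp [hdeg]),
      leadingCoeff_linear (inv_ne_zero hc), hψ.1.leadingCoeff, hψ.2, one_mul, ← mul_pow,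
      mul_inv_cancel₀ hc, one_pow]
  · rw [natDegree_C_mul (pow_ne_zero _ hc), natDegree_comp, hdeg, hψ.2, mul_one]

lemma eval_transplant (n : ℕ) (a b : ℝ) (ψ : ℝ[X]) (x : ℝ) :
    (transplant n a b ψ).eval x =
      ((b - a) / 2) ^ n * ψ.eval (2 / (b - a) * x - (a + b) / (b - a)) := by
  simp [transplant]

lemma transplant_bijOn (n : ℕ) (hab : a ≠ b) :
    Set.BijOn (transplant n a b) (monicPolys n) (monicPolys n) := by
  have hba : b - a ≠ 0 := sub_ne_zero.2 hab.symm
  have hc : (b - a) / 2 ≠ 0 := div_ne_zero hba two_ne_zero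
  let inv : ℝ[X] → ℝ[X] := fun φ =>
    C ((2 / (b - a)) ^ n) * φ.comp (C ((b - a) / 2) * X + C ((a + b) / 2))
  have hinv : Set.InvOn inv (transplant n a b) (monicPolys n) (monicPolys n) := by
    constructor <;> intro φ _ <;> refine Polynomial.funext fun x => ?_ <;>
      simp only [inv, transplant, eval_mul, eval_C, eval_comp, eval_add, eval_sub, eval_X] <;>
      rw [← mul_assoc, ← mul_pow]
    · have harg : 2 / (b - a) * ((b - a) / 2 * x + (a + b) / 2) - (a + b) / (b - a) = x := by
        field_simp
        ring
      rw [harg, div_mul_div_cancel₀ hba, div_self two_ne_zero, one_pow, one_mul]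
    · have harg : (b - a) / 2 * (2 / (b - a) * x - (a + b) / (b - a)) + (a + b) / 2 = x := by
        field_simp
        ring
      rw [harg, div_mul_div_cancel₀ two_ne_zero, div_self hba, one_pow, one_mul]
  refine hinv.bijOn (fun ψ hψ => ?_) fun φ hφ => ?_
  · have h := C_pow_mul_comp_mem_monicPolys hψ hc (-((a + b) / (b - a)))
    rwa [inv_div, C_neg, ← sub_eq_add_neg] at h
  · have h := C_pow_mul_comp_mem_monicPolys hφ (inv_ne_zero hc) ((a + b) / 2)
    rwa [inv_inv, inv_div] at h

lemma iterate_derivative_eq_C_factorial (hψ : ψ ∈ monicPolys n) :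
    derivative^[n] ψ = C (n.factorial : ℝ) := by
  have hdeg : (derivative^[n] ψ).natDegree = 0 := by
    simpa [hψ.2] using natDegree_iterate_derivative ψ n
  have hcoeff : ψ.coeff n = 1 := hψ.2 ▸ hψ.1
  rw [eq_C_of_natDegree_eq_zero hdeg, coeff_iterate_derivative]
  simp [hcoeff, Nat.descFactorial_self]

lemma ae_eval_ne_zero {P : ℝ[X]} (hP : P ≠ 0) (μ : Measure ℝ) [NullSingletonClass μ] :
    ∀ᵐ x ∂μ, P.eval x ≠ 0 := by
  filter_upwards [(finite_setOfPred_isRoot hP).countable.ae_notMem μ] with x hx using hx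

lemma eq_of_ae_eval_eq {μ : Measure ℝ} [NullSingletonClass μ] [NeZero μ]
    (h : ∀ᵐ x ∂μ, ψ.eval x = χ.eval x) : ψ = χ := by
  by_contra hne
  obtain ⟨x, hx, hx0⟩ := (h.and (ae_eval_ne_zero (sub_ne_zero.2 hne) μ)).exists
  exact hx0 (by rw [eval_sub, hx, sub_self])

lemma exists_mul_eval_nonneg_of_forall_not_isRoot {S : Set ℝ} (hS : IsPreconnected S) {P : ℝ[X]}
    (hroot : ∀ c ∈ S, ¬P.IsRoot c) : ∃ ε : ℝ, ε ≠ 0 ∧ ∀ x ∈ S, 0 ≤ ε * P.eval x := by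
  rcases S.eq_empty_or_nonempty with rfl | ⟨y, hy⟩
  · exact ⟨1, one_ne_zero, by simp⟩
  refine ⟨P.eval y, hroot y hy, fun x hx => ?_⟩
  by_contra! hlt
  obtain ⟨c, hc, hc0⟩ : (0 : ℝ) ∈ (fun z => P.eval y * P.eval z) '' S :=
    hS.intermediate_value hx hy (by fun_prop) ⟨hlt.le, mul_self_nonneg _⟩
  exact hroot c hc ((mul_eq_zero.1 hc0).resolve_left (hroot y hy))

lemma exists_finset_isRoot_mul_eval_nonneg {S : Set ℝ} (hS : IsPreconnected S) {P : ℝ[X]}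
    (hP : P ≠ 0) : ∃ T : Finset ℝ, (∀ c ∈ T, c ∈ S ∧ P.IsRoot c) ∧
      ∃ ε : ℝ, ε ≠ 0 ∧ ∀ x ∈ S, 0 ≤ ε * (P.eval x * (∏ c ∈ T, (X - C c)).eval x) := by
  induction hd : P.natDegree using Nat.strong_induction_on generalizing P with
  | _ d ih =>
  by_cases hroot : ∃ c ∈ S, P.IsRoot c
  swap
  · obtain ⟨ε, hε, h⟩ := exists_mul_eval_nonneg_of_forall_not_isRoot hS
      fun c hc hPc => hroot ⟨c, hc, hPc⟩
    exact ⟨∅, by simp, ε, hε, by simpa using h⟩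
  obtain ⟨c, hcS, hPc⟩ := hroot
  obtain ⟨R, rfl⟩ := dvd_iff_isRoot.2 hPc
  have hR : R ≠ 0 := right_ne_zero_of_mul hP
  obtain ⟨T, hT, ε, hε, hTε⟩ := ih R.natDegree
    (by rw [← hd, natDegree_mul (X_sub_C_ne_zero c) hR, natDegree_X_sub_C]; omega) hR rfl
  have hT_root : ∀ z ∈ T, z ∈ S ∧ ((X - C c) * R).IsRoot z := fun z hz =>
    ⟨(hT z hz).1, root_mul_left_of_isRoot _ (hT z hz).2⟩
  by_cases hcT : c ∈ T
  · refine ⟨T.erase c, fun z hz => hT_root z (Finset.mem_of_mem_erase hz), ε, hε,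
      fun x hx => ?_⟩
    have h := hTε x hx
    rwa [← Finset.mul_prod_erase T _ hcT, ← eval_mul, mul_left_comm, ← mul_assoc, eval_mul] at h
  · refine ⟨insert c T, ?_, ε, hε, fun x hx => ?_⟩
    · simpa only [Finset.forall_mem_insert] using ⟨⟨hcS, hPc⟩, hT_root⟩
    · rw [Finset.prod_insert hcT]
      simp only [eval_mul]
      calc 0 ≤ (X - C c : ℝ[X]).eval x ^ 2 *
            (ε * (R.eval x * (∏ z ∈ T, (X - C z)).eval x)) := mul_nonneg (sq_nonneg _) (hTε x hx)
        _ = _ := by ring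

end Polynomials

/-- `ψ` has the least `L^q` norm over `[a, b]` among the monic polynomials of degree `n`. On
`[-1, 1]` these are the polynomials that minimize `errorConst n p q`. -/
def IsLeastNormMonic (n : ℕ) (q : ℝ≥0∞) (a b : ℝ) (ψ : ℝ[X]) : Prop :=
  ψ ∈ monicPolys n ∧ ∀ χ ∈ monicPolys n,
    normOn (fun x => ψ.eval x) q a b ≤ normOn (fun x => χ.eval x) q a b

/-- A polynomial as an element of `L^q([a, b])`. Its norm there is `normOn`, so that the normed
space structure of `Lp` becomes available for `normOn`. -/
def toLpIcc (q : ℝ≥0∞) (a b : ℝ) : ℝ[X] →ₗ[ℝ] Lp ℝ q (volume.restrict (Set.Icc a b)) where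
  toFun P := (memLp_restrict_Icc P.continuous q a b).toLp
  map_add' P Q := by
    simp only [← MemLp.toLp_add, eval_add, Pi.add_def]
  map_smul' c P := by
    simp only [← MemLp.toLp_const_smul, eval_smul, Pi.smul_def, RingHom.id_apply]

section LeastNorm

variable {n : ℕ} {q : ℝ≥0∞} {a b : ℝ} {ψ χ : ℝ[X]}

lemma norm_toLpIcc (q : ℝ≥0∞) (a b : ℝ) (P : ℝ[X]) :
    ‖toLpIcc q a b P‖ = normOn (fun x => P.eval x) q a b := by
  rw [normOn, lpNorm, if_pos P.continuous.aestronglyMeasurable]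
  exact Lp.norm_toLp _ (memLp_restrict_Icc P.continuous q a b)

lemma convexOn_normOn_eval (hq : 1 ≤ q) (a b : ℝ) :
    ConvexOn ℝ Set.univ fun P : ℝ[X] => normOn (fun x => P.eval x) q a b := by
  have : Fact (1 ≤ q) := ⟨hq⟩
  simp only [← norm_toLpIcc]
  exact convexOn_univ_norm.comp_linearMap (toLpIcc q a b)

lemma exists_isLeastNormMonic (n : ℕ) (hq : 1 ≤ q) (a b : ℝ) :
    ∃ ψ, IsLeastNormMonic n q a b ψ := by
  have : Fact (1 ≤ q) := ⟨hq⟩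
  have : FiniteDimensional ℝ (degreeLT ℝ n) := (degreeLTEquiv ℝ n).symm.finiteDimensional
  obtain ⟨_, ⟨r, hr, rfl⟩, hmin⟩ :=
    exists_forall_norm_add_le ((degreeLT ℝ n).map (toLpIcc q a b)) (toLpIcc q a b (X ^ n))
  refine ⟨X ^ n + r, add_mem_monicPolys (X_pow_mem_monicPolys n) hr, fun χ hχ => ?_⟩
  have h := hmin _ (Submodule.mem_map_of_mem
    ((mem_monicPolys_iff_sub_mem_degreeLT (X_pow_mem_monicPolys n)).1 hχ))
  rwa [← map_add, ← map_add, add_sub_cancel, norm_toLpIcc, norm_toLpIcc] at h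

lemma convex_setOf_isLeastNormMonic (n : ℕ) (hq : 1 ≤ q) (a b : ℝ) :
    Convex ℝ {ψ | IsLeastNormMonic n q a b ψ} := by
  intro ψ hψ χ hχ s t hs ht hst
  refine ⟨convex_monicPolys n hψ.1 hχ.1 hs ht hst, fun ω hω => ?_⟩
  exact ((convexOn_normOn_eval hq a b).convex_le (normOn (fun x => ω.eval x) q a b)
    ⟨trivial, hψ.2 ω hω⟩ ⟨trivial, hχ.2 ω hω⟩ hs ht hst).2

lemma IsLeastNormMonic.normOn_le_normOn_midpoint {ω : ℝ[X]} (hω : IsLeastNormMonic n q a b ω)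
    (hψ : ψ ∈ monicPolys n) (hχ : χ ∈ monicPolys n) :
    normOn (fun x => ω.eval x) q a b ≤
      normOn (fun x => midpoint ℝ (ψ.eval x) (χ.eval x)) q a b := by
  simpa only [eval_midpoint] using hω.2 _ ((convex_monicPolys n).midpoint_mem hψ hχ)

lemma abs_le_normOn_top {g : ℝ → ℝ} (hg : Continuous g) (hab : a < b) {x : ℝ}
    (hx : x ∈ Set.Icc a b) : |g x| ≤ normOn g ∞ a b := by
  have hae : (fun x => max |g x| (normOn g ∞ a b)) =ᵐ[volume.restrict (Set.Icc a b)]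
      fun _ => normOn g ∞ a b := by
    filter_upwards [ae_le_lpNorm_exponent_top (memLp_restrict_Icc hg ∞ a b)] with y hy
    exact max_eq_right hy
  exact max_eq_right_iff.1
    (Measure.eqOn_Icc_of_ae_eq volume hab.ne hae (by fun_prop) continuousOn_const hx)

lemma IsLeastNormMonic.C_mul_eq_chebyshev (hψ : IsLeastNormMonic n ∞ (-1) 1 ψ) :
    C (2 ^ (n - 1)) * ψ = Chebyshev.T ℝ n := by
  have hpow : (0 : ℝ) < 2 ^ (n - 1) := by positivity
  have hT_monic : C ((2 ^ (n - 1))⁻¹) * Chebyshev.T ℝ n ∈ monicPolys n := by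
    constructor
    · rw [Monic, leadingCoeff_mul, leadingCoeff_C, Chebyshev.leadingCoeff_T, Int.natAbs_natCast]
      exact inv_mul_cancel₀ hpow.ne'
    · rw [natDegree_C_mul (inv_ne_zero hpow.ne'), Chebyshev.natDegree_T, Int.natAbs_natCast]
  have hT_norm : normOn (fun x => (C ((2 ^ (n - 1))⁻¹) * Chebyshev.T ℝ n).eval x) ∞ (-1) 1 ≤
      ((2 : ℝ) ^ (n - 1))⁻¹ := by
    refine lpNorm_top_le_of_ae_le (by positivity)
      (ae_restrict_of_forall_mem measurableSet_Icc fun x hx => ?_)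
    rw [eval_mul, eval_C, norm_mul, Real.norm_of_nonneg (by positivity)]
    exact mul_le_of_le_one_right (by positivity)
      (Chebyshev.abs_eval_T_real_le_one n (abs_le.2 hx))
  refine (Chebyshev.coeff_eq_iff_of_forall_abs_le_one ?_ fun x hx => ?_).1 ?_
  · rw [degree_C_mul hpow.ne', degree_eq_of_mem_monicPolys hψ.1]
  · rw [eval_mul, eval_C, abs_mul, abs_of_pos hpow, ← le_inv_mul_iff₀ hpow, mul_one]
    exact (abs_le_normOn_top ψ.continuous (by norm_num) hx).trans
      ((hψ.2 _ hT_monic).trans hT_norm)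
  · have hcoeff : ψ.coeff n = 1 := hψ.1.2 ▸ hψ.1.1
    rw [coeff_C_mul, hcoeff, mul_one]

lemma IsLeastNormMonic.integral_sign_mul_eq_zero (hψ : IsLeastNormMonic n 1 a b ψ)
    {r : ℝ[X]} (hr : r ∈ degreeLT ℝ n) :
    ∫ x in Set.Icc a b, SignType.sign (ψ.eval x) * r.eval x = 0 := by
  have hint : ∀ P : ℝ[X], Integrable (fun x => P.eval x) (volume.restrict (Set.Icc a b)) :=
    fun P => memLp_one_iff_integrable.1 (memLp_restrict_Icc P.continuous 1 a b)
  refine integral_sign_mul_eq_zero_of_forall_integral_abs_le (hint ψ) (hint r)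
    (ae_eval_ne_zero hψ.1.1.ne_zero _) fun t => ?_
  have h := hψ.2 _ (add_mem_monicPolys hψ.1 (Submodule.smul_mem _ t hr))
  rw [normOn, normOn, lpNorm_one_eq_integral_norm (hint _).1,
    lpNorm_one_eq_integral_norm (hint _).1] at h
  simpa only [Real.norm_eq_abs, eval_add, eval_smul, smul_eq_mul] using h

lemma IsLeastNormMonic.exists_finset_isRoot (hψ : IsLeastNormMonic n 1 a b ψ) (hab : a < b) :
    ∃ T : Finset ℝ, n ≤ T.card ∧ ∀ c ∈ T, c ∈ Set.Icc a b ∧ ψ.IsRoot c := by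
  have := neZero_restrict_Icc hab
  obtain ⟨T, hT, ε, hε, hsign⟩ :=
    exists_finset_isRoot_mul_eval_nonneg (isPreconnected_Icc (a := a) (b := b)) hψ.1.1.ne_zero
  refine ⟨T, ?_, hT⟩
  by_contra! hcard
  set r : ℝ[X] := ∏ c ∈ T, (X - C c)
  have hr_monic : r.Monic := monic_prod_of_monic _ _ fun c _ => monic_X_sub_C c
  have hr_deg : r ∈ degreeLT ℝ n := by
    rw [mem_degreeLT, degree_prod]
    simpa using hcard
  have hψ_ae := ae_eval_ne_zero hψ.1.1.ne_zero (volume.restrict (Set.Icc a b))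
  have hnonneg : 0 ≤ᵐ[volume.restrict (Set.Icc a b)] fun x =>
      ε * (SignType.sign (ψ.eval x) * r.eval x) := by
    filter_upwards [hψ_ae, ae_restrict_mem measurableSet_Icc] with x hx hx_Icc
    refine (mul_nonneg_iff_of_pos_left (abs_pos.2 hx)).1 ((hsign x hx_Icc).trans_eq ?_)
    nth_rw 1 [← sign_mul_abs (ψ.eval x)]
    ring
  have hzero := (integral_eq_zero_iff_of_nonneg_ae hnonneg ?_).1 ?_
  · obtain ⟨x, hx, hψx, hrx⟩ := (hzero.and (hψ_ae.and (ae_eval_ne_zero hr_monic.ne_zero _))).exists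
    have hsign_ne : (SignType.sign (ψ.eval x) : ℝ) ≠ 0 := fun h0 =>
      hψx (by rw [← sign_mul_abs (ψ.eval x), h0, zero_mul])
    exact mul_ne_zero hε (mul_ne_zero hsign_ne hrx) hx
  · refine Integrable.const_mul (Integrable.bdd_mul (c := 1)
      (memLp_one_iff_integrable.1 (memLp_restrict_Icc r.continuous 1 a b))
      (aestronglyMeasurable_coe_sign ψ.continuous.aestronglyMeasurable)
      (.of_forall fun x => abs_coe_sign_le_one _)) ε
  · rw [integral_const_mul, hψ.integral_sign_mul_eq_zero hr_deg, mul_zero]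

lemma IsLeastNormMonic.eq_of_one (hψ : IsLeastNormMonic n 1 a b ψ)
    (hχ : IsLeastNormMonic n 1 a b χ) (hab : a < b) : ψ = χ := by
  have hmid_ae : ∀ᵐ x ∂volume.restrict (Set.Icc a b),
      |midpoint ℝ (ψ.eval x) (χ.eval x)| = (|ψ.eval x| + |χ.eval x|) / 2 := by
    simpa using ae_norm_midpoint_rpow_eq_of_lpNorm_le le_rfl ENNReal.one_ne_top
      (memLp_restrict_Icc ψ.continuous 1 a b) (memLp_restrict_Icc χ.continuous 1 a b)
      (hψ.normOn_le_normOn_midpoint hψ.1 hχ.1) (hχ.normOn_le_normOn_midpoint hψ.1 hχ.1)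
  have hmid : ∀ x ∈ Set.Icc a b, |(midpoint ℝ ψ χ).eval x| = (|ψ.eval x| + |χ.eval x|) / 2 := by
    simp only [← eval_midpoint] at hmid_ae
    exact Measure.eqOn_Icc_of_ae_eq volume hab.ne hmid_ae (by fun_prop) (by fun_prop)
  obtain ⟨T, hT_card, hT⟩ := IsLeastNormMonic.exists_finset_isRoot
    ((convex_setOf_isLeastNormMonic n le_rfl a b).midpoint_mem hψ hχ) hab
  have hdeg : (ψ - χ).degree < T.card :=
    (mem_degreeLT.1 ((mem_monicPolys_iff_sub_mem_degreeLT hχ.1).1 hψ.1)).trans_le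
      (by exact_mod_cast hT_card)
  refine eq_of_degree_sub_lt_of_eval_finset_eq T hdeg fun c hc => ?_
  have hsum : |ψ.eval c| + |χ.eval c| = 0 := by
    have h := hmid c (hT c hc).1
    rw [(hT c hc).2.eq_zero, abs_zero] at h
    linarith
  have hroots := (add_eq_zero_iff_of_nonneg (abs_nonneg _) (abs_nonneg _)).1 hsum
  rw [abs_eq_zero.1 hroots.1, abs_eq_zero.1 hroots.2]

lemma IsLeastNormMonic.eq_of_one_lt_of_ne_top (hq : 1 < q) (hq' : q ≠ ∞)
    (hψ : IsLeastNormMonic n q a b ψ) (hχ : IsLeastNormMonic n q a b χ) (hab : a < b) : ψ = χ := by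
  have := neZero_restrict_Icc hab
  exact eq_of_ae_eval_eq (ae_eq_of_lpNorm_le_lpNorm_midpoint hq hq'
    (memLp_restrict_Icc ψ.continuous q a b) (memLp_restrict_Icc χ.continuous q a b)
    (hψ.normOn_le_normOn_midpoint hψ.1 hχ.1) (hχ.normOn_le_normOn_midpoint hψ.1 hχ.1))

lemma existsUnique_isLeastNormMonic (n : ℕ) (hq : 1 ≤ q) :
    ∃! ψ, IsLeastNormMonic n q (-1) 1 ψ := by
  obtain ⟨ψ, hψ⟩ := exists_isLeastNormMonic n hq (-1) 1
  refine ⟨ψ, hψ, fun χ hχ => ?_⟩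
  have hlt : (-1 : ℝ) < 1 := by norm_num
  rcases hq.eq_or_lt with rfl | hq_one
  · exact hχ.eq_of_one hψ hlt
  rcases eq_or_ne q ∞ with rfl | hq_top
  · exact mul_left_cancel₀ (C_ne_zero.2 (pow_ne_zero (n - 1) two_ne_zero))
      (hχ.C_mul_eq_chebyshev.trans hψ.C_mul_eq_chebyshev.symm)
  · exact IsLeastNormMonic.eq_of_one_lt_of_ne_top hq_one hq_top hχ hψ hlt

end LeastNorm

section Regularity

variable {m n k : ℕ} {f g : ℝ → ℝ} {a b : ℝ} {p q : ℝ≥0∞}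

lemma exists_iteratedDeriv_eq (n : ℕ) (hg : Continuous g) :
    ∃ f : ℝ → ℝ, ContDiff ℝ n f ∧ iteratedDeriv n f = g := by
  induction n with
  | zero => exact ⟨g, contDiff_zero.2 hg, iteratedDeriv_zero⟩
  | succ n ih =>
    obtain ⟨F, hF, hFg⟩ := ih
    have hderiv : ∀ x, HasDerivAt (fun x => ∫ t in (0 : ℝ)..x, F t) (F x) x := fun x =>
      hF.continuous.integral_hasStrictDerivAt 0 x |>.hasDerivAt
    have hderiv_eq : deriv (fun x => ∫ t in (0 : ℝ)..x, F t) = F := deriv_eq hderiv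
    refine ⟨fun x => ∫ t in (0 : ℝ)..x, F t, ?_, ?_⟩
    · rw [Nat.cast_add_one, contDiff_succ_iff_deriv, hderiv_eq]
      exact ⟨fun x => (hderiv x).differentiableAt, by simp, hF⟩
    · rw [iteratedDeriv_succ', hderiv_eq, hFg]

lemma absolutelyContinuousOnInterval_congr (h : Set.EqOn f g (Set.uIcc a b))
    (hf : AbsolutelyContinuousOnInterval f a b) : AbsolutelyContinuousOnInterval g a b := by
  rw [absolutelyContinuousOnInterval_iff] at hf ⊢
  refine fun ε hε => (hf ε hε).imp fun δ hδ => ⟨hδ.1, fun E hE hEδ => ?_⟩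
  convert hδ.2 E hE hEδ using 2 with i hi
  have hmem := hE.1 i hi
  rw [h hmem.1, h hmem.2]

lemma derivOn_eq_iteratedDeriv (hf : ContDiff ℝ n f) (hab : a < b) :
    Set.EqOn (derivOn n f a b) (iteratedDeriv n f) (Set.Icc a b) := fun _ hx =>
  iteratedDerivWithin_eq_iteratedDeriv (uniqueDiffOn_Icc hab) hf.contDiffAt hx

lemma derivOn_succ_eq_deriv (k : ℕ) (f : ℝ → ℝ) {x : ℝ} (hx : x ∈ Set.Ioo a b) :
    derivOn (k + 1) f a b x = deriv (derivOn k f a b) x := by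
  rw [derivOn, iteratedDerivWithin_succ, derivWithin_of_mem_nhds (Icc_mem_nhds hx.1 hx.2), derivOn]

lemma absolutelyContinuousOnInterval_derivOn (hkm : k < m) (hab : a < b)
    (hf : ContDiffOn ℝ m f (Set.Icc a b)) :
    AbsolutelyContinuousOnInterval (derivOn k f a b) a b := by
  have hf' : ContDiffOn ℝ (k + 1 : ℕ) f (Set.Icc a b) := hf.of_le (by exact_mod_cast hkm)
  refine ContDiffOn.absolutelyContinuousOnInterval ?_
  rw [Set.uIcc_of_le hab.le]
  exact ((contDiffOn_nat_succ_iff_contDiffOn_one_iteratedDerivWithin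
    (uniqueDiffOn_Icc hab)).1 hf').2

lemma IsRegular.absolutelyContinuous_derivOn (hf : IsRegular n p a b f) (hab : a < b)
    (hkn : k < n) : AbsolutelyContinuousOnInterval (derivOn k f a b) a b := by
  rcases (Nat.le_sub_one_of_lt hkn).eq_or_lt with rfl | hlt
  · exact hf.absolutelyContinuous
  · exact absolutelyContinuousOnInterval_derivOn hlt hab hf.contDiffOn

lemma IsRegular.intervalIntegrable (hf : IsRegular n p a b f) (hab : a ≤ b) :
    IntervalIntegrable f volume a b :=
  hf.contDiffOn.continuousOn.intervalIntegrable_of_Icc hab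

lemma exists_isRegular (hn : 1 ≤ n) (hp : 1 ≤ p) (hab : a < b)
    (hg : MemLp g p (volume.restrict (Set.Icc a b))) :
    ∃ f, IsRegular n p a b f ∧ derivOn n f a b =ᵐ[volume.restrict (Set.Icc a b)] g := by
  obtain ⟨m, rfl⟩ := Nat.exists_eq_add_of_le' hn
  set G := (Set.Icc a b).indicator g
  have hG : Integrable G := (integrable_indicator_iff measurableSet_Icc).2 (hg.integrable hp)
  have hG_interval := hG.intervalIntegrable (a := a) (b := b)
  set F := fun x => ∫ t in a..x, G t
  have hF : Continuous F :=
    intervalIntegral.continuous_primitive (fun _ _ => hG.intervalIntegrable) a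
  obtain ⟨f, hf, hfF⟩ := exists_iteratedDeriv_eq m hF
  have hfF_on : Set.EqOn (derivOn m f a b) F (Set.Icc a b) :=
    hfF ▸ derivOn_eq_iteratedDeriv hf hab
  have hfg : derivOn (m + 1) f a b =ᵐ[volume.restrict (Set.Icc a b)] g := by
    rw [← restrict_Ioo_eq_restrict_Icc, Filter.EventuallyEq, ae_restrict_iff' measurableSet_Ioo]
    filter_upwards [hG_interval.ae_hasDerivAt_integral] with x hx hx_Ioo
    have hx_Icc := Set.Ioo_subset_Icc_self hx_Ioo
    have hF_deriv : deriv F x = G x :=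
      (hx (Set.Icc_subset_uIcc hx_Icc) a Set.left_mem_uIcc).deriv
    have hfF_nhds : derivOn m f a b =ᶠ[nhds x] F :=
      hfF_on.eventuallyEq_of_mem (Icc_mem_nhds hx_Ioo.1 hx_Ioo.2)
    rw [derivOn_succ_eq_deriv m f hx_Ioo, hfF_nhds.deriv_eq, hF_deriv]
    exact Set.indicator_of_mem hx_Icc g
  refine ⟨f, ⟨hf.contDiffOn, ?_, (memLp_congr_ae hfg).2 hg⟩, hfg⟩
  refine absolutelyContinuousOnInterval_congr ?_
    (hG_interval.absolutelyContinuousOnInterval_intervalIntegral Set.left_mem_uIcc)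
  rw [Set.uIcc_of_le hab.le]
  exact hfF_on.symm

lemma integral_eval_mul_derivOn_succ (hf : AbsolutelyContinuousOnInterval (derivOn k f a b) a b)
    (χ : ℝ[X]) (hab : a ≤ b) :
    ∫ x in a..b, χ.eval x * derivOn (k + 1) f a b x =
      χ.eval b * derivOn k f a b b - χ.eval a * derivOn k f a b a -
        ∫ x in a..b, (derivative χ).eval x * derivOn k f a b x := by
  have hχ : AbsolutelyContinuousOnInterval (fun x => χ.eval x) a b :=
    ContDiffOn.absolutelyContinuousOnInterval
      (by simpa only [coe_aeval_eq_eval] using (χ.contDiff_aeval (𝕜 := ℝ) 1).contDiffOn)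
  have hparts := AbsolutelyContinuousOnInterval.integral_mul_deriv_eq_deriv_mul hχ hf
  simp only [Polynomial.deriv] at hparts
  rw [← hparts]
  refine intervalIntegral.integral_congr_ae_restrict ?_
  rw [Set.uIoc_of_le hab, ← restrict_Ioo_eq_restrict_Ioc]
  filter_upwards [ae_restrict_mem measurableSet_Ioo] with x hx
  rw [derivOn_succ_eq_deriv k f hx]

lemma IsRegular.integral_iterate_derivative_mul (hf : IsRegular n p a b f) (hab : a < b)
    (φ : ℝ[X]) (hmn : m ≤ n) :
    ∫ x in a..b, (derivative^[n] φ).eval x * f x =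
      ∑ k ∈ Finset.range m, (-1) ^ k *
        ((derivative^[n - k - 1] φ).eval b * derivOn k f a b b -
          (derivative^[n - k - 1] φ).eval a * derivOn k f a b a) +
      (-1) ^ m * ∫ x in a..b, (derivative^[n - m] φ).eval x * derivOn m f a b x := by
  induction m with
  | zero => simp [derivOn]
  | succ m ih =>
    have hsub : n - m = n - (m + 1) + 1 := by omega
    rw [ih (by omega), Finset.sum_range_succ, Nat.sub_sub,
      integral_eval_mul_derivOn_succ (hf.absolutelyContinuous_derivOn hab hmn) _ hab.le,
      ← Function.iterate_succ_apply' (f := derivative), Nat.succ_eq_add_one, ← hsub]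
    ring

lemma IsRegular.integral_eq_quadrature_add_errorTerm (hf : IsRegular n p a b f) (hab : a < b)
    {φ : ℝ[X]} (hφ : φ ∈ monicPolys n) :
    ∫ x in a..b, f x = quadrature n φ f a b + errorTerm n φ f a b := by
  have hfac : (n.factorial : ℝ) ≠ 0 := by positivity
  have hparts := hf.integral_iterate_derivative_mul hab φ le_rfl
  simp only [iterate_derivative_eq_C_factorial hφ, eval_C, intervalIntegral.integral_const_mul,
    tsub_self, Function.iterate_zero, id_eq] at hparts
  have hsign : ∀ k < n, (-1 : ℝ) ^ n * (-1) ^ (n - k - 1) = -(-1) ^ k := by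
    intro k hk
    have hsum : n + (n - k - 1) = 2 * (n - k - 1) + (k + 1) := by omega
    rw [← pow_add, hsum, pow_add, pow_mul, neg_one_sq, one_pow, one_mul, pow_succ, mul_neg_one]
  rw [← mul_right_inj' hfac, hparts, quadrature, errorTerm, mul_add, ← mul_assoc, ← mul_assoc,
    mul_div_cancel₀ _ hfac, Finset.mul_sum]
  congr 1
  · refine Finset.sum_congr rfl fun k hk => ?_
    rw [← mul_assoc, hsign k (Finset.mem_range.1 hk)]
    ring
  · simp only [mul_comm]

lemma abs_errorTerm (n : ℕ) (φ : ℝ[X]) (f : ℝ → ℝ) (hab : a ≤ b) :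
    |errorTerm n φ f a b| =
      |∫ x in Set.Icc a b, derivOn n f a b x * φ.eval x| / (n.factorial : ℝ) := by
  rw [errorTerm, intervalIntegral.integral_of_le hab, ← integral_Icc_eq_integral_Ioc, abs_mul,
    abs_div, abs_pow, abs_neg, abs_one, one_pow, Nat.abs_cast, one_div_mul_eq_div]

lemma IsRegular.intervalIntegrable_derivOn_mul [p.HolderConjugate q] (hf : IsRegular n p a b f)
    (hab : a ≤ b) (φ : ℝ[X]) :
    IntervalIntegrable (fun x => derivOn n f a b x * φ.eval x) volume a b := by
  rw [intervalIntegrable_iff_integrableOn_Icc_of_le hab]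
  exact hf.memLp.integrable_mul (memLp_restrict_Icc φ.continuous q a b)

lemma IsRegular.abs_errorTerm_le [p.HolderConjugate q] (hf : IsRegular n p a b f) (hab : a ≤ b)
    (φ : ℝ[X]) :
    |errorTerm n φ f a b| ≤
      normOn (derivOn n f a b) p a b * normOn (fun x => φ.eval x) q a b / (n.factorial : ℝ) := by
  rw [abs_errorTerm n φ f hab]
  gcongr
  exact abs_integral_mul_le_lpNorm_mul_lpNorm hf.memLp (memLp_restrict_Icc φ.continuous q a b)

end Regularity

section ErrorConstants

variable {n : ℕ} {p q : ℝ≥0∞} {a b c : ℝ}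

lemma normOn_const (hp : p ≠ 0) (hab : a < b) (c : ℝ) :
    normOn (fun _ => c) p a b = |c| * (b - a) ^ (p⁻¹).toReal := by
  have := neZero_restrict_Icc hab
  rw [normOn, lpNorm_const hp (NeZero.ne _), measureReal_restrict_apply_univ,
    Real.volume_real_Icc_of_le hab.le, Real.norm_eq_abs, ENNReal.toReal_inv]

lemma normOn_transplant (n : ℕ) (q : ℝ≥0∞) (hab : a < b) (ψ : ℝ[X]) :
    normOn (fun x => (transplant n a b ψ).eval x) q a b =
      (2 : ℝ) ^ (-(n : ℝ) - (q⁻¹).toReal) * normOn (fun x => ψ.eval x) q (-1) 1 *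
        (b - a) ^ ((n : ℝ) + (q⁻¹).toReal) := by
  have hba : 0 < b - a := sub_pos.2 hab
  have hleft : 2 / (b - a) * a + -((a + b) / (b - a)) = -1 := by
    field_simp
    ring
  have hright : 2 / (b - a) * b + -((a + b) / (b - a)) = 1 := by
    field_simp
    ring
  have hscale := normOn_comp_mul_add (fun x => ψ.eval x) q (c := 2 / (b - a)) (by positivity)
    (-((a + b) / (b - a))) a b
  have htransplant : (fun x => (transplant n a b ψ).eval x) =
      ((b - a) / 2) ^ n • fun x => ψ.eval (2 / (b - a) * x + -((a + b) / (b - a))) :=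
    funext fun x => by
      rw [eval_transplant, sub_eq_add_neg (2 / (b - a) * x), Pi.smul_apply, smul_eq_mul]
  rw [hleft, hright, normOn] at hscale
  rw [htransplant, normOn, lpNorm_const_smul, hscale, ← inv_div (b - a) 2,
    Real.inv_rpow (by positivity), Real.rpow_neg (by positivity), inv_inv, ← neg_add',
    Real.rpow_neg two_pos.le, Real.rpow_add two_pos, Real.rpow_add hba, Real.rpow_natCast,
    Real.rpow_natCast, Real.div_rpow hba.le two_pos.le, coe_nnnorm,
    Real.norm_of_nonneg (by positivity), div_pow]
  field_simp

lemma isLeast_admissibleConstants (hn : 1 ≤ n) (hp : 1 ≤ p) (q : ℝ≥0∞) (ψ : ℝ[X]) :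
    IsLeast (admissibleConstants n p q ψ)
      ((2 : ℝ) ^ (-(n : ℝ) - (q⁻¹).toReal) * normOn (fun x => ψ.eval x) q (-1) 1 /
        (n.factorial : ℝ)) := by
  refine ⟨fun a b hab f _ => ?_, fun K hK => ?_⟩
  · rw [normOn_transplant n q hab]
    exact le_of_eq (by ring)
  · obtain ⟨f, hf, hf_one⟩ := exists_isRegular hn hp zero_lt_one
      (memLp_restrict_Icc (continuous_const (y := (1 : ℝ))) p 0 1)
    have hnorm : normOn (derivOn n f 0 1) p 0 1 = 1 := by
      rw [normOn, lpNorm_congr_ae hf_one]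
      simpa [normOn] using normOn_const (zero_lt_one.trans_le hp).ne' zero_lt_one 1
    simpa [hnorm, normOn_transplant n q zero_lt_one ψ] using hK 0 1 zero_lt_one f hf

lemma errorConst_eq (hn : 1 ≤ n) (hp : 1 ≤ p) (q : ℝ≥0∞) (ψ : ℝ[X]) :
    errorConst n p q ψ =
      (2 : ℝ) ^ (-(n : ℝ) - (q⁻¹).toReal) * normOn (fun x => ψ.eval x) q (-1) 1 /
        (n.factorial : ℝ) :=
  (isLeast_admissibleConstants hn hp q ψ).csInf_eq

lemma errorConst_mul_rpow (hn : 1 ≤ n) (hp : 1 ≤ p) (q : ℝ≥0∞) (ψ : ℝ[X]) (hab : a < b) :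
    errorConst n p q ψ * (b - a) ^ ((n : ℝ) + (q⁻¹).toReal) =
      normOn (fun x => (transplant n a b ψ).eval x) q a b / (n.factorial : ℝ) := by
  rw [errorConst_eq hn hp, normOn_transplant n q hab]
  ring

lemma isMinimizer_iff (hn : 1 ≤ n) (hp : 1 ≤ p) (q : ℝ≥0∞) (ψ : ℝ[X]) :
    IsMinimizer n p q ψ ↔ IsLeastNormMonic n q (-1) 1 ψ := by
  refine and_congr_right fun _ => forall₂_congr fun χ _ => ?_
  rw [errorConst_eq hn hp, errorConst_eq hn hp, div_le_div_iff_of_pos_right (by positivity),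
    mul_le_mul_iff_right₀ (by positivity)]

lemma isLeast_errorTerm_bound [p.HolderConjugate q] (hn : 1 ≤ n) (φ : ℝ[X]) (hab : a < b) :
    IsLeast {c : ℝ | ∀ f, IsRegular n p a b f →
        |errorTerm n φ f a b| ≤ c * normOn (derivOn n f a b) p a b}
      (normOn (fun x => φ.eval x) q a b / (n.factorial : ℝ)) := by
  have hp : 1 ≤ p := ENNReal.HolderConjugate.one_le p q
  refine ⟨fun f hf => ?_, fun c hc => ?_⟩
  · rw [div_mul_eq_mul_div, mul_comm]
    exact hf.abs_errorTerm_le hab.le φ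
  have hbound : ∀ g, MemLp g p (volume.restrict (Set.Icc a b)) →
      |∫ x in Set.Icc a b, g x * φ.eval x| ≤ c * (n.factorial : ℝ) * normOn g p a b := by
    intro g hg
    obtain ⟨f, hf, hfg⟩ := exists_isRegular hn hp hab hg
    have h := hc f hf
    rw [abs_errorTerm n φ f hab.le, normOn, lpNorm_congr_ae hfg,
      integral_congr_ae (hfg.fun_mul (.refl _ _)), div_le_iff₀ (by positivity)] at h
    rwa [mul_right_comm]
  have hc0 : 0 ≤ c * (n.factorial : ℝ) := by
    have hone := hbound (fun _ => 1) (memLp_restrict_Icc continuous_const p a b)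
    rw [normOn_const (zero_lt_one.trans_le hp).ne' hab] at hone
    exact nonneg_of_mul_nonneg_left ((abs_nonneg _).trans hone)
      (mul_pos (by norm_num) (Real.rpow_pos_of_pos (sub_pos.2 hab) _))
  rw [div_le_iff₀ (by positivity)]
  exact lpNorm_le_of_forall_abs_integral_mul_le (memLp_restrict_Icc φ.continuous q a b) hc0 hbound

end ErrorConstants

end CorrectedTrapezoid

end

theorem mainTheorem1 (n : ℕ) (hn : 1 ≤ n) (p q : ℝ≥0∞) (hpq : ENNReal.HolderConjugate p q) :
    -- the quadrature formula and the first error estimate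
    (∀ (a b : ℝ), a < b → ∀ f : ℝ → ℝ, CorrectedTrapezoid.IsRegular n p a b f →
      ∀ φ ∈ CorrectedTrapezoid.monicPolys n,
        IntervalIntegrable f volume a b ∧
        IntervalIntegrable (fun x => CorrectedTrapezoid.derivOn n f a b x * φ.eval x)
          volume a b ∧
        (∫ x in a..b, f x) = CorrectedTrapezoid.quadrature n φ f a b +
          CorrectedTrapezoid.errorTerm n φ f a b ∧
        |CorrectedTrapezoid.errorTerm n φ f a b| ≤
          CorrectedTrapezoid.normOn (CorrectedTrapezoid.derivOn n f a b) p a b *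
            CorrectedTrapezoid.normOn (fun x => φ.eval x) q a b / (n.factorial : ℝ)) ∧
    -- every `φ` on `[a, b]` comes from exactly one `ψ`, and the second error estimate holds
    -- with the constant that belongs to `ψ`, which involves neither `f` nor `a`, `b`
    (∀ (a b : ℝ), a < b → ∀ φ ∈ CorrectedTrapezoid.monicPolys n,
      (∃! ψ : ℝ[X], ψ ∈ CorrectedTrapezoid.monicPolys n ∧
        φ = CorrectedTrapezoid.transplant n a b ψ) ∧
      ∀ ψ ∈ CorrectedTrapezoid.monicPolys n, φ = CorrectedTrapezoid.transplant n a b ψ →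
        ∀ f : ℝ → ℝ, CorrectedTrapezoid.IsRegular n p a b f →
          CorrectedTrapezoid.normOn (CorrectedTrapezoid.derivOn n f a b) p a b *
              CorrectedTrapezoid.normOn (fun x => φ.eval x) q a b / (n.factorial : ℝ) ≤
            CorrectedTrapezoid.errorConst n p q ψ *
              CorrectedTrapezoid.normOn (CorrectedTrapezoid.derivOn n f a b) p a b *
              (b - a) ^ ((n : ℝ) + (q⁻¹).toReal)) ∧
    -- the constant that belongs to `ψ` is the least admissible one
    (∀ ψ ∈ CorrectedTrapezoid.monicPolys n,
      (∀ a b : ℝ, a < b →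
        CorrectedTrapezoid.transplant n a b ψ ∈ CorrectedTrapezoid.monicPolys n) ∧
      IsLeast (CorrectedTrapezoid.admissibleConstants n p q ψ)
        (CorrectedTrapezoid.errorConst n p q ψ)) ∧
    -- the unique minimizer, the minimum value, and sharpness on every interval
    (∃! ψ : ℝ[X], CorrectedTrapezoid.IsMinimizer n p q ψ) ∧
    (∀ ψ : ℝ[X], CorrectedTrapezoid.IsMinimizer n p q ψ →
      CorrectedTrapezoid.errorConst n p q ψ =
        (2 : ℝ) ^ (-(n : ℝ) - (q⁻¹).toReal) *
          CorrectedTrapezoid.normOn (fun x => ψ.eval x) q (-1) 1 / (n.factorial : ℝ) ∧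
      ∀ a b : ℝ, a < b →
        IsLeast {c : ℝ | ∀ f : ℝ → ℝ, CorrectedTrapezoid.IsRegular n p a b f →
            |CorrectedTrapezoid.errorTerm n (CorrectedTrapezoid.transplant n a b ψ) f a b| ≤
              c * CorrectedTrapezoid.normOn (CorrectedTrapezoid.derivOn n f a b) p a b}
          (CorrectedTrapezoid.errorConst n p q ψ * (b - a) ^ ((n : ℝ) + (q⁻¹).toReal))) := by
  have hp : 1 ≤ p := ENNReal.HolderConjugate.one_le p q
  have hleast (ψ : ℝ[X]) : IsLeast (CorrectedTrapezoid.admissibleConstants n p q ψ)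
      (CorrectedTrapezoid.errorConst n p q ψ) :=
    CorrectedTrapezoid.errorConst_eq hn hp q ψ ▸
      CorrectedTrapezoid.isLeast_admissibleConstants hn hp q ψ
  have hbij {a b : ℝ} (hab : a < b) := CorrectedTrapezoid.transplant_bijOn n hab.ne
  refine ⟨fun a b hab f hf φ hφ => ?_, fun a b hab φ hφ => ⟨?_, ?_⟩,
    fun ψ hψ => ⟨fun a b hab => (hbij hab).mapsTo hψ, hleast ψ⟩, ?_, fun ψ _ =>
      ⟨CorrectedTrapezoid.errorConst_eq hn hp q ψ, fun a b hab => ?_⟩⟩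
  · exact ⟨hf.intervalIntegrable hab.le, hf.intervalIntegrable_derivOn_mul (q := q) hab.le φ,
      hf.integral_eq_quadrature_add_errorTerm hab hφ, hf.abs_errorTerm_le hab.le φ⟩
  · obtain ⟨ψ, hψ, rfl⟩ := (hbij hab).surjOn hφ
    exact ⟨ψ, ⟨hψ, rfl⟩, fun χ hχ => (hbij hab).injOn hχ.1 hψ hχ.2.symm⟩
  · rintro ψ - rfl f hf
    exact (hleast ψ).1 a b hab f hf
  · simpa only [CorrectedTrapezoid.isMinimizer_iff hn hp] using
      CorrectedTrapezoid.existsUnique_isLeastNormMonic n (ENNReal.HolderConjugate.one_le q p)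
  · exact CorrectedTrapezoid.errorConst_mul_rpow hn hp q ψ hab ▸
      CorrectedTrapezoid.isLeast_errorTerm_bound hn _ hab
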